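/- Let $p$ be a prime number, let $k$ be a field of characteristic $p$, let $n\ge 0$, and let $G=S_n$ be the symmetric group. Let $B=kGb$ be a block of $kG$, where $b$ is a primitive idempotent of the centre $Z(kG)$, and suppose that $B$ has a nontrivial defect group $P$; here a defect group of $B$ is a subgroup $P$ of $G$ that is minimal among the subgroups $Q\le G$ with $b\in \mathrm{Tr}_Q^G\big((kG)^Q\big)$, where $(kG)^Q$ consists of the elements of $kG$ fixed under conjugation by $Q$ and $\mathrm{Tr}_Q^G(a)=\sum_{g\in G/Q} g a g^{-1}$. Then $$\mathrm{HH}^1(B,B)=\mathrm{Ext}^1_{B\otimes_k B^{\mathrm{op}}}(B,B)\neq 0 .$$ -/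

import Mathlib

open scoped TensorProduct

universe u v

namespace IsIdempotentElem

variable {k : Type u} {A : Type v} [Field k] [Ring A] [Algebra k A] {e : A}

/-- Scalars act on the corner ring `e A e` as they do on `A`. -/
instance cornerSMul (he : IsIdempotentElem e) : SMul k he.Corner where
  smul c x := ⟨c • x.1, by
    obtain ⟨y, hy⟩ := x.2
    exact ⟨c • y, by simp only [mul_smul_comm, smul_mul_assoc]; exact congrArg (c • ·) hy⟩⟩

/-- The inclusion of the corner ring `e A e` into `A`, an additive map. -/
def cornerVal (he : IsIdempotentElem e) : he.Corner →+ A where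
  toFun x := x.1
  map_zero' := rfl
  map_add' _ _ := rfl

/-- The corner `e A e` is a `k`-submodule of `A`. -/
instance cornerModule (he : IsIdempotentElem e) : Module k he.Corner :=
  Function.Injective.module k he.cornerVal (fun _ _ h => Subtype.ext h) (fun _ _ => rfl)

/-- The corner ring `e A e`, with identity element `e`, as a `k`-algebra. -/
instance cornerAlgebra (he : IsIdempotentElem e) : Algebra k he.Corner :=
  Algebra.ofModule
    (fun c x y => Subtype.ext (smul_mul_assoc c x.1 y.1))
    (fun c x y => Subtype.ext (mul_smul_comm c x.1 y.1))

end IsIdempotentElem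

/-- The Hochschild cohomology group `HH^m(A, A) = Ext^m(A, A)` of a `k`-algebra `A`, the Ext group
being taken over the enveloping algebra `A ⊗[k] Aᵐᵒᵖ`, which acts on `A` by
`(a ⊗ op a') • x = a * x * a'`. -/
abbrev HochschildCohomology (k A : Type u) [Field k] [Ring A] [Algebra k A] (m : ℕ) : Type u :=
  letI : Module (A ⊗[k] Aᵐᵒᵖ) A := instModuleTensorProductMop k A
  CategoryTheory.Abelian.Ext
    (ModuleCat.of (A ⊗[k] Aᵐᵒᵖ) A) (ModuleCat.of (A ⊗[k] Aᵐᵒᵖ) A) m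

/-- `b` is a block idempotent of the ring `A`: a primitive idempotent of the centre of `A`. -/
structure IsBlockIdempotent {A : Type u} [Ring A] (b : A) : Prop where
  central : b ∈ Subring.center A
  idem : IsIdempotentElem b
  ne_zero : b ≠ 0
  primitive : ∀ e ∈ Subring.center A, IsIdempotentElem e → e * b = e → e = 0 ∨ e = b

/-- The block `B = b A = b A b` of `A` attached to the block idempotent `b`; it is a ring with
identity element `b`. -/
abbrev IsBlockIdempotent.Block {A : Type u} [Ring A] {b : A} (hb : IsBlockIdempotent b) : Type u :=
  hb.idem.Corner

section GroupAlgebra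

variable {k : Type u} [Field k] {G : Type v} [Group G]

/-- The conjugate `g a g⁻¹` of an element `a` of the group algebra `kG`. -/
noncomputable def groupAlgebraConj (g : G) (a : MonoidAlgebra k G) : MonoidAlgebra k G :=
  MonoidAlgebra.of k G g * a * MonoidAlgebra.of k G g⁻¹

/-- `a` lies in `(kG)^Q`, the elements of `kG` fixed under conjugation by `Q`. -/
def IsFixedBy (Q : Subgroup G) (a : MonoidAlgebra k G) : Prop :=
  ∀ h ∈ Q, groupAlgebraConj h a = a

/-- The relative trace `Tr_Q^G(a) = ∑ g a g⁻¹`, where `g` runs over representatives of the left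
cosets `G / Q`. It is applied only to `a ∈ (kG)^Q`, where the choice of the representatives is
immaterial. -/
noncomputable def relTrace [Fintype G] (Q : Subgroup G) (a : MonoidAlgebra k G) :
    MonoidAlgebra k G :=
  letI : Fintype (G ⧸ Q) := Fintype.ofFinite _
  ∑ x : G ⧸ Q, groupAlgebraConj x.out a

theorem groupAlgebraConj_mul (g h : G) (a : MonoidAlgebra k G) :
    groupAlgebraConj (g * h) a = groupAlgebraConj g (groupAlgebraConj h a) := by
  simp only [groupAlgebraConj, mul_inv_rev, map_mul, mul_assoc]

theorem groupAlgebraConj_eq_of_mk_eq {Q : Subgroup G} {a : MonoidAlgebra k G}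
    (ha : IsFixedBy Q a) {g g' : G} (h : (g : G ⧸ Q) = (g' : G ⧸ Q)) :
    groupAlgebraConj g a = groupAlgebraConj g' a := by
  have h1 := ha _ (QuotientGroup.eq.mp h)
  conv_lhs => rw [← h1, ← groupAlgebraConj_mul, mul_inv_cancel_left]

/-- `P` is a defect group of the block of `kG` with block idempotent `b`: a subgroup that is minimal
among the subgroups `Q` of `G` such that `b ∈ Tr_Q^G((kG)^Q)`. -/
def IsDefectGroup [Fintype G] (b : MonoidAlgebra k G) (P : Subgroup G) : Prop :=
  Minimal (fun Q : Subgroup G => ∃ a : MonoidAlgebra k G, IsFixedBy Q a ∧ relTrace Q a = b) P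

end GroupAlgebra

/-! A derivation `D` of an algebra twists the bimodule structure on `A × A` into an extension of `A`
by itself that splits only if `D` is inner. It is therefore enough to find a derivation of `kG`
whose product with `b` is not inner, or equivalently a 1-cocycle `δ : G → kG` (conjugation action)
such that `b δ` is not a coboundary. As in the centralizer decomposition of HH¹(kG), a homomorphism
`f : C(c) → k` induces a cocycle supported on the conjugacy class of `c`.

Write Br_R for truncation to `C(R)`, which is multiplicative on `R`-invariants when `R` is a
`p`-group. Nontrivial defect gives an element `u` of order `p` with Br_u(b) ≠ 0
(`exists_relTrace_bot_eq`). In a symmetric group `u` can be replaced by one of its cycles `c`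
(`exists_commute_coeff_ne_zero`), a `p`-cycle. Now `C(c)` is the product of `⟨c⟩` and the symmetric
group on the fixed points, so projection to `⟨c⟩` gives `f` with `f c = 1`. For well-chosen
conjugators, `δ(c)` is the sum of the `i⁻¹ cⁱ` with 0 < i < p.

If `b δ` were the coboundary of `y`, then `b δ(c) = y - c y c⁻¹` would have zero truncation to
`C(c)`. That truncation is Br_c(b) δ(c), which is nonzero by `mul_sum_ne_zero`. -/

/-! ### Derivations, self-extensions of the regular bimodule, and HH¹. -/

section DerivationExtension

variable {k A : Type u} [Field k] [Ring A] [Algebra k A]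

/-- The left action of `A` on `A × A` twisted by a derivation `D`:
`a • (x, y) = (a x + D(a) y, a y)`. -/
def derivationLeftAction (D : A →ₗ[k] A) (hD : ∀ x y, D (x * y) = x * D y + D x * y) :
    A →ₐ[k] Module.End k (A × A) :=
  AlgHom.ofLinearMap
    (LinearMap.mk₂ k (fun a z => (a * z.1 + D a * z.2, a * z.2))
      (fun a a' z => by ext <;> simp [add_mul, add_add_add_comm])
      (fun c a z => by ext <;> simp)
      (fun a z z' => by ext <;> simp [mul_add, add_add_add_comm])
      (fun c a z => by ext <;> simp))
    (by
      have h1 : D 1 = 0 := by simpa using hD 1 1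
      ext z <;> simp [h1])
    (fun a a' => by
      refine LinearMap.ext fun z => ?_
      ext <;> simp [hD, mul_add, add_mul, mul_assoc, add_assoc])

/-- The right multiplication action of `A` on `A × A`. -/
def rightMulAction (k A : Type u) [Field k] [Ring A] [Algebra k A] :
    Aᵐᵒᵖ →ₐ[k] Module.End k (A × A) :=
  AlgHom.ofLinearMap
    (LinearMap.mk₂ k (fun a z => (z.1 * a.unop, z.2 * a.unop))
      (fun a a' z => by ext <;> simp [mul_add])
      (fun c a z => by ext <;> simp)
      (fun a z z' => by ext <;> simp [add_mul])
      (fun c a z => by ext <;> simp))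
    (by ext z <;> simp)
    (fun a a' => by
      refine LinearMap.ext fun z => ?_
      ext <;> simp [mul_assoc])

/-- The bimodule structure on `A × A` given by a derivation of `A`. -/
def derivationBimoduleAction (D : A →ₗ[k] A) (hD : ∀ x y, D (x * y) = x * D y + D x * y) :
    A ⊗[k] Aᵐᵒᵖ →ₐ[k] Module.End k (A × A) :=
  Algebra.TensorProduct.lift (derivationLeftAction D hD) (rightMulAction k A)
    (fun a a' => by
      refine LinearMap.ext fun z => ?_
      ext <;> simp [derivationLeftAction, rightMulAction, add_mul, mul_assoc])

/-- The extension of `A` by itself, as a bimodule, attached to a derivation of `A`. -/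
def DerivationExtension (D : A →ₗ[k] A) (_ : ∀ x y, D (x * y) = x * D y + D x * y) : Type u :=
  A × A

variable (D : A →ₗ[k] A) (hD : ∀ x y, D (x * y) = x * D y + D x * y)

instance : AddCommGroup (DerivationExtension D hD) := inferInstanceAs (AddCommGroup (A × A))

instance : Module (A ⊗[k] Aᵐᵒᵖ) (DerivationExtension D hD) :=
  letI : Module (Module.End k (A × A)) (DerivationExtension D hD) :=
    inferInstanceAs (Module (Module.End k (A × A)) (A × A))
  Module.compHom _ (derivationBimoduleAction D hD).toRingHom

theorem DerivationExtension.tmul_smul (a : A) (a' : Aᵐᵒᵖ) (x y : A) :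
    (a ⊗ₜ[k] a') • (show DerivationExtension D hD from (x, y)) =
      (show DerivationExtension D hD from
        ((a * (x * a'.unop) + D a * (y * a'.unop)), a * (y * a'.unop))) := rfl

attribute [local instance] instModuleTensorProductMop

theorem bimodule_tmul_smul (a : A) (a' : Aᵐᵒᵖ) (x : A) :
    (a ⊗ₜ[k] a' : A ⊗[k] Aᵐᵒᵖ) • x = a * (x * a'.unop) := by
  rw [TensorProduct.Algebra.smul_def]; simp

/-- The inclusion of `A` in the extension. -/
def DerivationExtension.inl : A →ₗ[A ⊗[k] Aᵐᵒᵖ] DerivationExtension D hD where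
  toFun x := (show A × A from (x, 0))
  map_add' x y := by
    refine Prod.ext ?_ ?_
    · rfl
    · exact (add_zero (0 : A)).symm
  map_smul' r x := by
    induction r with
    | zero =>
      refine Eq.trans ?_
        (zero_smul (A ⊗[k] Aᵐᵒᵖ) (show DerivationExtension D hD from (show A × A from (x, 0)))).symm
      exact Prod.ext (zero_smul (A ⊗[k] Aᵐᵒᵖ) x) rfl
    | tmul a a' =>
      refine Prod.ext ?_ ?_
      · change (a ⊗ₜ[k] a' : A ⊗[k] Aᵐᵒᵖ) • x = a * (x * a'.unop) + D a * (0 * a'.unop)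
        rw [bimodule_tmul_smul, zero_mul, mul_zero, add_zero]
      · change (0 : A) = a * (0 * a'.unop)
        rw [zero_mul, mul_zero]
    | add r s hr hs =>
      refine Eq.trans ?_ ((congrArg₂ (· + ·) hr hs).trans
        (add_smul r s (show DerivationExtension D hD from (show A × A from (x, 0)))).symm)
      refine Prod.ext (add_smul r s x) (add_zero (0 : A)).symm

/-- The projection of the extension onto `A`. -/
def DerivationExtension.snd : DerivationExtension D hD →ₗ[A ⊗[k] Aᵐᵒᵖ] A where
  toFun x := (show A × A from x).2
  map_add' x y := rfl
  map_smul' r x := by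
    induction r with
    | zero => simp only [RingHom.id_apply]; rfl
    | tmul a a' =>
      rw [RingHom.id_apply, bimodule_tmul_smul]
      rfl
    | add r s hr hs =>
      simp only [RingHom.id_apply, add_smul] at hr hs ⊢
      rw [← hr, ← hs]
      rfl

/-- A section sends `1` to some `(m, 1)`, and `a • 1 = 1 • a` forces `a m + D a = m a`. -/
theorem DerivationExtension.exists_eq_sub_of_section
    (s : A →ₗ[A ⊗[k] Aᵐᵒᵖ] DerivationExtension D hD)
    (hs : ∀ x, DerivationExtension.snd D hD (s x) = x) : ∃ y, ∀ x, D x = x * y - y * x := by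
  let m : A × A := s (1 : A)
  refine ⟨-m.1, fun a => ?_⟩
  have h1 : s ((a ⊗ₜ[k] (1 : Aᵐᵒᵖ) : A ⊗[k] Aᵐᵒᵖ) • (1 : A)) =
      (show A × A from (a * (m.1 * 1) + D a * (m.2 * 1), a * (m.2 * 1))) :=
    s.map_smul (a ⊗ₜ[k] (1 : Aᵐᵒᵖ)) (1 : A)
  have h2 : s (((1 : A) ⊗ₜ[k] (MulOpposite.op a) : A ⊗[k] Aᵐᵒᵖ) • (1 : A)) =
      (show A × A from (1 * (m.1 * a) + D 1 * (m.2 * a), 1 * (m.2 * a))) :=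
    s.map_smul ((1 : A) ⊗ₜ[k] (MulOpposite.op a)) (1 : A)
  rw [bimodule_tmul_smul] at h1 h2
  have hm : m.2 = 1 := hs 1
  have hD1 : D 1 = 0 := by simpa using hD 1 1
  simp only [MulOpposite.unop_one, MulOpposite.unop_op, one_mul, mul_one, hm, hD1, zero_mul,
    add_zero] at h1 h2
  have h3 : a * m.1 + D a = m.1 * a := congrArg (fun z : A × A => z.1) (h1.symm.trans h2)
  rw [← sub_eq_of_eq_add' h3.symm]
  simp [sub_eq_add_neg, add_comm]

end DerivationExtension

-- The connecting map sends the identity of `S.X₃` to the extension class; when this vanishes, the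
-- identity lifts along `S.g`.
open CategoryTheory in
theorem CategoryTheory.ShortComplex.ShortExact.exists_section {C : Type*} [Category C]
    [Abelian C] [HasExt C] {S : ShortComplex C} (hS : S.ShortExact)
    (h : hS.extClass = 0) : ∃ s : S.X₃ ⟶ S.X₂, s ≫ S.g = 𝟙 _ := by
  obtain ⟨s, hs⟩ := Abelian.Ext.covariant_sequence_exact₃ S.X₃ hS
    (Abelian.Ext.mk₀ (𝟙 _)) (n₁ := 1) rfl (by simp [h])
  obtain ⟨s, rfl⟩ := Abelian.Ext.homEquiv₀.symm.surjective s
  rw [Abelian.Ext.homEquiv₀_symm_apply, Abelian.Ext.mk₀_comp_mk₀] at hs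
  exact ⟨s, Abelian.Ext.homEquiv₀.symm.injective hs⟩

section

variable {k A : Type u} [Field k] [Ring A] [Algebra k A]

attribute [local instance] instModuleTensorProductMop

open CategoryTheory

/-- The short complex of bimodules underlying the extension attached to a derivation. -/
abbrev derivationShortComplex (D : A →ₗ[k] A)
    (hD : ∀ x y, D (x * y) = x * D y + D x * y) :
    ShortComplex (ModuleCat.{u} (A ⊗[k] Aᵐᵒᵖ)) :=
  ShortComplex.mk (ModuleCat.ofHom (DerivationExtension.inl D hD))
    (ModuleCat.ofHom (DerivationExtension.snd D hD)) (by ext; rfl)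

theorem derivationShortComplex_shortExact (D : A →ₗ[k] A)
    (hD : ∀ x y, D (x * y) = x * D y + D x * y) :
    (derivationShortComplex D hD).ShortExact where
  exact := by
    rw [ShortComplex.moduleCat_exact_iff]
    rintro ⟨x, y⟩ h
    have h : y = 0 := h
    exact ⟨x, by subst h; rfl⟩
  mono_f := by
    rw [ModuleCat.mono_iff_injective]
    intro x y h
    exact congrArg (fun z : A × A => z.1) h
  epi_g := by
    rw [ModuleCat.epi_iff_surjective]
    intro y
    exact ⟨(show A × A from (0, y)), rfl⟩

theorem nontrivial_hochschildCohomology_one_of_derivation (D : A →ₗ[k] A)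
    (hD : ∀ x y, D (x * y) = x * D y + D x * y)
    (hn : ¬ ∃ y, ∀ x, D x = x * y - y * x) : Nontrivial (HochschildCohomology k A 1) := by
  by_contra hc
  rw [not_nontrivial_iff_subsingleton] at hc
  obtain ⟨s, hs⟩ := (derivationShortComplex_shortExact D hD).exists_section
    (hc.elim _ _)
  exact hn (DerivationExtension.exists_eq_sub_of_section D hD s.hom
    fun x => congrArg (fun t => t.hom x) hs)

/-- A derivation `D` of an algebra induces a derivation of the corner ring of a central idempotent
`b`; if `b D` is not inner then the corner has nonzero first Hochschild cohomology. -/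
theorem nontrivial_hochschildCohomology_corner_of_derivation (D : A →ₗ[k] A)
    (hD : ∀ x y, D (x * y) = x * D y + D x * y)
    {b : A} (hb : IsIdempotentElem b)
    (hc : ∀ a, b * a = a * b)
    (hn : ¬ ∃ y, ∀ x, D x * b = x * y - y * x) :
    Nontrivial (HochschildCohomology k hb.Corner 1) := by
  have hmem : ∀ x : hb.Corner, b * x.1 = x.1 ∧ x.1 * b = x.1 :=
    fun x => (Subsemigroup.mem_corner_iff hb).mp x.2
  -- Multiplying `D b = b D(b) + D(b) b` by `b` gives `b D(b) b = 0`, and `b` is central.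
  have hDb : D b = 0 := by
    have h1 : D b = b * D b + D b * b := by rw [← hD, hb.eq]
    have h2 : b * D b = 0 := by
      have := congrArg (b * ·) h1
      simp only [mul_add, ← mul_assoc, hb.eq] at this
      rw [mul_assoc, ← hc, ← mul_assoc, hb.eq] at this
      simpa using this
    rw [h1, ← hc, h2, add_zero]
  have hDm : ∀ x, D (x * b) = D x * b := fun x => by rw [hD, hDb, mul_zero, zero_add]
  let DB : hb.Corner →ₗ[k] hb.Corner :=
    { toFun := fun x => ⟨D x.1, (Subsemigroup.mem_corner_iff hb).mpr (by
        have := hDm x.1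
        rw [(hmem x).2] at this
        exact ⟨by rw [hc, ← this], this.symm⟩)⟩
      map_add' := fun x y => Subtype.ext (D.map_add x.1 y.1)
      map_smul' := fun c x => Subtype.ext (D.map_smul c x.1) }
  refine nontrivial_hochschildCohomology_one_of_derivation DB
    (fun x y => Subtype.ext (hD x.1 y.1)) ?_
  rintro ⟨y, hy⟩
  refine hn ⟨y.1, fun x => ?_⟩
  have h1 := congrArg Subtype.val (hy ⟨x * b, (Subsemigroup.mem_corner_iff hb).mpr
    ⟨by rw [hc, mul_assoc, hb.eq], by rw [mul_assoc, hb.eq]⟩⟩)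
  have h2 : D (x * b) = x * b * y.1 - y.1 * (x * b) := h1
  rw [hDm, mul_assoc x, (hmem y).1, ← hc x, ← mul_assoc y.1, (hmem y).2] at h2
  exact h2

end

/-! ### Cancellation over `p`-groups, the Brauer map, and traces from the trivial subgroup. -/

section ClassFunctions

variable {k : Type u} [Field k] {G : Type v} [Group G] (p : ℕ) [CharP k p]

/-- In characteristic `p`, a function invariant under a `p`-group and vanishing at the fixed points
has sum zero. -/
theorem IsPGroup.sum_eq_zero [Fact p.Prime] {R X : Type*} [Group R] (hR : IsPGroup p R)
    [MulAction R X] [Fintype X] (h : X → k) (hinv : ∀ (r : R) x, h (r • x) = h x)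
    (h0 : ∀ x ∈ MulAction.fixedPoints R X, h x = 0) : ∑ x, h x = 0 := by
  classical
  rw [show ∑ x, h x = ∑ x, id (h x) from rfl, Finset.sum_comp id h]
  refine Finset.sum_eq_zero fun c _ => ?_
  by_cases hc : c = 0
  · simp [hc]
  -- A level set for a nonzero value is stable without fixed points, so `p` divides its size.
  let Y : SubMulAction R X :=
    { carrier := {x | h x = c}
      smul_mem' := fun r x hx => (hinv r x).trans hx }
  have h1 := hR.card_modEq_card_fixedPoints Y
  have h2 : IsEmpty (MulAction.fixedPoints R Y) := by
    refine ⟨fun ⟨⟨x, hx⟩, hf⟩ => hc ?_⟩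
    rw [← show h x = c from hx]
    exact h0 x fun r => congrArg Subtype.val (hf r)
  rw [Nat.card_of_isEmpty (α := MulAction.fixedPoints R Y), Nat.modEq_zero_iff_dvd] at h1
  have h3 : Nat.card Y = (Finset.univ.filter fun x => h x = c).card := by
    exact (Nat.card_eq_fintype_card (α := {x // h x = c})).trans (Fintype.card_subtype _)
  rw [h3] at h1
  rw [nsmul_eq_mul, (CharP.cast_eq_zero_iff k p _).mpr h1, zero_mul]

theorem IsPGroup.sum_eq_zero_of_conj [Fact p.Prime] [Fintype G] {R : Subgroup G}
    (hR : IsPGroup p R) (h : G → k) (hinv : ∀ r ∈ R, ∀ x, h (r * x * r⁻¹) = h x)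
    (h0 : ∀ x ∈ Subgroup.centralizer (R : Set G), h x = 0) : ∑ x, h x = 0 := by
  let _ : MulAction R G := MulAction.compHom G ((MulAut.conj (G := G)).comp R.subtype)
  refine IsPGroup.sum_eq_zero p hR h (fun r x => hinv r.1 r.2 x) fun x hx => h0 x ?_
  rw [Subgroup.mem_centralizer_iff]
  intro r hr
  have : r * x * r⁻¹ = x := hx ⟨r, hr⟩
  exact mul_inv_eq_iff_eq_mul.mp this

namespace MonoidAlgebra

theorem coeff_mul_eq_sum [Fintype G] (a b : MonoidAlgebra k G) (g : G) :
    (a * b).coeff g = ∑ x, a.coeff x * b.coeff (x⁻¹ * g) := by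
  rw [coeff_mul_apply_left, Finsupp.sum_fintype]
  simp

/-- The coefficients of `a` are invariant under conjugation by `R`. -/
def ConjInvariant (R : Set G) (a : MonoidAlgebra k G) : Prop :=
  ∀ r ∈ R, ∀ x, a.coeff (r * x * r⁻¹) = a.coeff x

theorem conjInvariant_of_central {a : MonoidAlgebra k G} (ha : a ∈ Subring.center _) (R : Set G) :
    ConjInvariant R a := fun r _ x => by
  have h := congrArg (fun z => z.coeff (r * x)) (Subring.mem_center_iff.mp ha (single r 1))
  simpa using h.symm

open Classical in
/-- The truncation of an element of `kG` to the centralizer of a subset `R` of `G`; for a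
`p`-subgroup `R` this is the Brauer map. -/
noncomputable def brauer (R : Set G) (a : MonoidAlgebra k G) : MonoidAlgebra k G :=
  ofCoeff (a.coeff.filter (· ∈ Subgroup.centralizer R))

theorem coeff_brauer_of_mem {R : Set G} (a : MonoidAlgebra k G) {x : G}
    (hx : x ∈ Subgroup.centralizer R) : (brauer R a).coeff x = a.coeff x := by
  classical exact Finsupp.filter_apply_pos _ _ hx

theorem coeff_brauer_of_notMem {R : Set G} (a : MonoidAlgebra k G) {x : G}
    (hx : x ∉ Subgroup.centralizer R) : (brauer R a).coeff x = 0 := by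
  classical exact Finsupp.filter_apply_neg _ _ hx

theorem ConjInvariant.brauer {R S : Set G} {a : MonoidAlgebra k G} (ha : ConjInvariant S a)
    (hS : ∀ s ∈ S, ∀ x, s * x * s⁻¹ ∈ Subgroup.centralizer R ↔ x ∈ Subgroup.centralizer R) :
    ConjInvariant S (brauer R a) := fun s hs x => by
  by_cases hx : x ∈ Subgroup.centralizer R
  · rw [coeff_brauer_of_mem _ hx, coeff_brauer_of_mem _ ((hS s hs x).mpr hx), ha s hs]
  · rw [coeff_brauer_of_notMem _ hx, coeff_brauer_of_notMem _ (mt (hS s hs x).mp hx)]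

theorem conj_mem_centralizer_iff {R : Set G} {s : G}
    (h : ∀ r, s * r * s⁻¹ ∈ R ↔ r ∈ R) (x : G) :
    s * x * s⁻¹ ∈ Subgroup.centralizer R ↔ x ∈ Subgroup.centralizer R := by
  simp only [Subgroup.mem_centralizer_iff]
  refine ⟨fun hx r hr => ?_, fun hx r hr => ?_⟩
  · have h1 := hx _ ((h r).mpr hr)
    rw [← mul_right_inj s⁻¹, ← mul_left_inj s] at h1
    simpa [mul_assoc] using h1
  · have h1 := hx (s⁻¹ * r * s) ((h _).mp (by simpa [mul_assoc] using hr))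
    rw [← mul_right_inj s, ← mul_left_inj s⁻¹] at h1
    simpa [mul_assoc] using h1

theorem ConjInvariant.brauer_self {R : Subgroup G} {a : MonoidAlgebra k G}
    (ha : ConjInvariant R a) : ConjInvariant R (MonoidAlgebra.brauer (R : Set G) a) :=
  ha.brauer fun _ hs x => conj_mem_centralizer_iff (fun _ => by
    rw [SetLike.mem_coe, SetLike.mem_coe, R.mul_mem_cancel_right (R.inv_mem hs),
      R.mul_mem_cancel_left hs]) x

/-- For `g` centralizing `R`, the terms of the convolution at `g` indexed by `x` outside `C(R)` are
constant on `R`-conjugacy orbits, none of which is a point, so they cancel in characteristic `p`. -/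
theorem brauer_mul [Fact p.Prime] [Fintype G] {R : Subgroup G} (hR : IsPGroup p R)
    {a b : MonoidAlgebra k G} (ha : ConjInvariant R a) (hb : ConjInvariant R b) :
    brauer (R : Set G) (a * b) = brauer (R : Set G) a * brauer (R : Set G) b := by
  ext g
  by_cases hg : g ∈ Subgroup.centralizer (R : Set G)
  · rw [coeff_brauer_of_mem _ hg, coeff_mul_eq_sum, coeff_mul_eq_sum, ← sub_eq_zero,
      ← Finset.sum_sub_distrib]
    refine IsPGroup.sum_eq_zero_of_conj p hR _ (fun r hr x => ?_) fun x hx => ?_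
    · have h1 : (r * x * r⁻¹)⁻¹ * g = r * (x⁻¹ * g) * r⁻¹ := by
        have h2 : r⁻¹ * g = g * r⁻¹ := by
          rw [inv_mul_eq_iff_eq_mul, ← mul_assoc, eq_mul_inv_iff_mul_eq]
          exact (Subgroup.mem_centralizer_iff.mp hg r hr).symm
        simp only [mul_inv_rev, inv_inv, mul_assoc, h2]
      rw [h1, ha r hr, hb r hr, ha.brauer_self r hr, hb.brauer_self r hr]
    · rw [coeff_brauer_of_mem _ hx,
        coeff_brauer_of_mem _ (mul_mem (inv_mem hx) hg), sub_self]
  · rw [coeff_brauer_of_notMem _ hg, coeff_mul_eq_sum]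
    refine (Finset.sum_eq_zero fun x _ => ?_).symm
    by_cases hx : x ∈ Subgroup.centralizer (R : Set G)
    · rw [coeff_brauer_of_notMem b (fun h => hg ?_), mul_zero]
      simpa using mul_mem hx h
    · rw [coeff_brauer_of_notMem _ hx, zero_mul]

end MonoidAlgebra

/-- Commuting unipotent elements have a common fixed vector: treat them one at a time, replacing `m`
by the last nonzero `(s - 1) ^ j * m`. -/
theorem exists_ne_zero_fixed_of_nilpotent {A : Type*} [Ring A] {e : A} (he0 : e ≠ 0)
    (hee : e * e = e) (S : Finset A) (hS : ∀ s ∈ S, IsNilpotent (s - 1))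
    (hcomm : ∀ s ∈ S, Commute e s) (hpair : ∀ s ∈ S, ∀ t ∈ S, Commute s t) :
    ∃ m, m ≠ 0 ∧ e * m = m ∧ ∀ s ∈ S, s * m = m := by
  classical
  induction S using Finset.induction_on with
  | empty => exact ⟨e, he0, hee, by simp⟩
  | insert s S _ ih =>
    obtain ⟨m, hm0, hem, hSm⟩ := ih (fun t ht => hS t (Finset.mem_insert_of_mem ht))
      (fun t ht => hcomm t (Finset.mem_insert_of_mem ht))
      (fun t ht t' ht' => hpair t (Finset.mem_insert_of_mem ht) t' (Finset.mem_insert_of_mem ht'))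
    have hs := Finset.mem_insert_self s S
    obtain ⟨n, hn⟩ := hS s hs
    have hex : ∃ j, (s - 1) ^ j * m = 0 := ⟨n, by rw [hn, zero_mul]⟩
    obtain ⟨j, hj⟩ : ∃ j, Nat.find hex = j + 1 := by
      refine Nat.exists_eq_succ_of_ne_zero fun h => hm0 ?_
      simpa [h] using Nat.find_spec hex
    have hswap : ∀ t, Commute t s → t * m = m → t * ((s - 1) ^ j * m) = (s - 1) ^ j * m :=
      fun t hts htm => by
        rw [← mul_assoc, ((hts.sub_right (Commute.one_right t)).pow_right j).eq, mul_assoc, htm]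
    refine ⟨(s - 1) ^ j * m, Nat.find_min hex (by omega), hswap e (hcomm s hs) hem, ?_⟩
    intro t ht
    rcases Finset.mem_insert.mp ht with rfl | ht'
    · have h1 := Nat.find_spec hex
      rw [hj, pow_succ', mul_assoc, sub_mul, one_mul, sub_eq_zero] at h1
      exact h1
    · exact hswap t (hpair t ht s hs) (hSm t ht')

theorem relTrace_bot [Fintype G] (a : MonoidAlgebra k G) (y : G) :
    (relTrace ⊥ a).coeff y = ∑ g : G, a.coeff (g⁻¹ * y * g) := by
  let _ : Fintype (G ⧸ (⊥ : Subgroup G)) := Fintype.ofFinite _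
  have h1 : Function.Bijective (fun x : G ⧸ (⊥ : Subgroup G) => x.out) := by
    refine ⟨fun x y h => ?_, fun g => ⟨(g : G ⧸ (⊥ : Subgroup G)), ?_⟩⟩
    · rw [← QuotientGroup.out_eq' x, ← QuotientGroup.out_eq' y]
      exact congrArg _ h
    · have := QuotientGroup.mk_out_eq_mul (⊥ : Subgroup G) g
      obtain ⟨⟨h, hh⟩, h2⟩ := this
      rw [Subgroup.mem_bot] at hh
      simpa [hh] using h2
  rw [relTrace, MonoidAlgebra.coeff_sum, Finsupp.finsetSum_apply]
  rw [← h1.sum_comp]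
  refine Finset.sum_congr rfl fun x _ => ?_
  simp [groupAlgebraConj, MonoidAlgebra.of_apply, mul_assoc]

/-- Place on one representative of each class the coefficient of `b` divided by the order of the
centralizer; the trace meets that representative exactly that many times. -/
theorem exists_relTrace_bot_eq [Fintype G] {b : MonoidAlgebra k G}
    (hb : b ∈ Subring.center (MonoidAlgebra k G))
    (h : ∀ g, b.coeff g ≠ 0 → ¬ p ∣ Nat.card (Subgroup.centralizer {g})) :
    ∃ a : MonoidAlgebra k G, IsFixedBy ⊥ a ∧ relTrace ⊥ a = b := by
  classical
  let rep : G → G := fun g => (ConjClasses.mk g).out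
  have hrep : ∀ g, IsConj (rep g) g := fun g =>
    ConjClasses.mk_eq_mk_iff_isConj.mp (Quotient.out_eq (ConjClasses.mk g))
  have hrep' : ∀ g y, IsConj g y → rep g = rep y := fun g y h => by
    simp only [rep, ConjClasses.mk_eq_mk_iff_isConj.mpr h]
  let a : MonoidAlgebra k G := MonoidAlgebra.ofCoeff (Finsupp.equivFunOnFinite.symm fun g =>
    if g = rep g then b.coeff g / (Nat.card (Subgroup.centralizer {g}) : k) else 0)
  refine ⟨a, fun h hh => ?_, ?_⟩
  · rw [Subgroup.mem_bot.mp hh]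
    simp [groupAlgebraConj, ← MonoidAlgebra.one_def]
  ext y
  rw [relTrace_bot]
  obtain ⟨c, hc⟩ := isConj_iff.mp (hrep y)
  have hc' : y * c = c * rep y := by rw [← mul_inv_eq_iff_eq_mul.mp hc.symm.symm]
  have hconj : ∀ g, rep (g⁻¹ * y * g) = rep y := fun g =>
    hrep' _ _ (isConj_iff.mpr ⟨g, by group⟩)
  have h1 : ∀ g, a.coeff (g⁻¹ * y * g) = if g⁻¹ * y * g = rep y then
      b.coeff y / (Nat.card (Subgroup.centralizer {rep y}) : k) else 0 := fun g => by
    change (if g⁻¹ * y * g = rep (g⁻¹ * y * g) then _ else _) = _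
    rw [hconj]
    split_ifs with h2
    · rw [← MonoidAlgebra.conjInvariant_of_central hb Set.univ g trivial (g⁻¹ * y * g), h2]
      congr 2
      rw [← h2]; group
    · rfl
  simp only [h1]
  rw [← Finset.sum_filter, Finset.sum_const, nsmul_eq_mul]
  have h2 : (Finset.univ.filter fun g => g⁻¹ * y * g = rep y).card =
      Nat.card (Subgroup.centralizer {rep y}) := by
    rw [← Fintype.card_subtype, ← Nat.card_eq_fintype_card]
    refine Nat.card_congr
      { toFun := fun g => ⟨c⁻¹ * g.1, ?_⟩
        invFun := fun z => ⟨c * z.1, ?_⟩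
        left_inv := fun g => Subtype.ext (by simp)
        right_inv := fun g => Subtype.ext (by simp) }
    · rw [Subgroup.mem_centralizer_singleton_iff]
      have h3 : y * g.1 = g.1 * rep y := by
        have := congrArg (g.1 * ·) g.2
        simpa [mul_assoc] using this
      rw [mul_assoc, ← h3, ← mul_assoc, ← mul_assoc]
      congr 1
      rw [inv_mul_eq_iff_eq_mul, ← mul_assoc, eq_mul_inv_iff_mul_eq, ← hc']
    · have h3 := Subgroup.mem_centralizer_singleton_iff.mp z.2
      rw [mul_inv_rev, mul_assoc, mul_assoc, ← mul_assoc y c, hc', mul_assoc, ← h3,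
        inv_mul_cancel_left, inv_mul_cancel_left]
  rw [h2]
  -- Off the support of `b` the centralizer order may be zero in `k`, but the numerator is zero too.
  by_cases hby : b.coeff y = 0
  · simp [hby]
  rw [mul_div_cancel₀]
  intro h3
  rw [CharP.cast_eq_zero_iff k p] at h3
  refine h (rep y) ?_ h3
  rwa [← MonoidAlgebra.conjInvariant_of_central hb Set.univ c trivial, hc]

end ClassFunctions

/-! ### Nonvanishing of Brauer images and of their products. -/

section BrauerSupport

variable {k : Type u} [Field k] {G : Type v} [Group G]

namespace MonoidAlgebra

theorem coeff_mul_of_mem_closure {S : Set G} {m : MonoidAlgebra k G}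
    (hm : ∀ s ∈ S, single s 1 * m = m) {v : G} (hv : v ∈ Subgroup.closure S) (x : G) :
    m.coeff (v * x) = m.coeff x := by
  induction hv using Subgroup.closure_induction generalizing x with
  | mem s hs =>
    conv_lhs => rw [← hm s hs]
    simp
  | one => rw [one_mul]
  | mul v w _ _ hv hw => rw [mul_assoc, hv, hw]
  | inv v _ hv => rw [← hv, mul_inv_cancel_left]

theorem commute_single_of_conjInvariant {S : Set G} {e : MonoidAlgebra k G}
    (he : ConjInvariant S e) {s : G} (hs : s ∈ S) : Commute e (single s 1) := by
  ext x
  simpa using he s hs (s⁻¹ * x)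

theorem isNilpotent_single_sub_one (p : ℕ) [Fact p.Prime] [CharP k p] {s : G} (hs : s ^ p = 1) :
    IsNilpotent (single s 1 - 1 : MonoidAlgebra k G) := by
  have : CharP (MonoidAlgebra k G) p :=
    charP_of_injective_algebraMap (algebraMap k (MonoidAlgebra k G)).injective p
  refine ⟨p, ?_⟩
  rw [sub_pow_char_of_commute _ (Commute.one_right _), one_pow, single_pow, hs, one_pow,
    ← one_def, sub_self]

end MonoidAlgebra

open MonoidAlgebra

theorem isPGroup_closure_of_commute {p : ℕ} {S : Set G}
    (hS : ∀ s ∈ S, s ^ p = 1) (hcomm : ∀ s ∈ S, ∀ t ∈ S, Commute s t) :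
    IsPGroup p (Subgroup.closure S) := by
  have h1 : Subgroup.closure S ≤ Subgroup.centralizer (Subgroup.closure S : Set G) := by
    rw [Subgroup.centralizer_closure, Subgroup.closure_le]
    intro s hs
    rw [SetLike.mem_coe, Subgroup.mem_centralizer_iff]
    exact fun t ht => hcomm t ht s hs
  rintro ⟨v, hv⟩
  refine ⟨1, Subtype.ext ?_⟩
  rw [pow_one]
  change v ^ p = 1
  induction hv using Subgroup.closure_induction with
  | mem s hs => exact hS s hs
  | one => exact one_pow p
  | mul x y hx hy hx1 hy1 =>
    have h2 : Commute x y := Subgroup.mem_centralizer_iff.mp (h1 hy) x hx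
    rw [h2.mul_pow, hx1, hy1, one_mul]
  | inv x _ hx1 => rw [inv_pow, hx1, inv_one]

theorem isPGroup_zpowers {p : ℕ} {u : G} (hu : u ^ p = 1) : IsPGroup p (Subgroup.zpowers u) := by
  rw [Subgroup.zpowers_eq_closure]
  exact isPGroup_closure_of_commute (by simpa) (by simp)

theorem mem_centralizer_zpowers_iff {u x : G} :
    x ∈ Subgroup.centralizer (Subgroup.zpowers u : Set G) ↔ Commute u x := by
  rw [Subgroup.zpowers_eq_closure, Subgroup.centralizer_closure,
    Subgroup.mem_centralizer_singleton_iff]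
  exact ⟨fun h => h.symm, fun h => h.symm⟩

/-- If the Brauer image at `u` of a central idempotent `b` is nonzero, and `S` is a set of commuting
elements of order `p` normalized by the centralizer of `u`, then so is the Brauer image of `b` at
the group generated by `S`. -/
theorem exists_commute_coeff_ne_zero [Fintype G] (p : ℕ) [Fact p.Prime] [CharP k p]
    {b : MonoidAlgebra k G} (hb : b ∈ Subring.center (MonoidAlgebra k G)) (hbi : b * b = b)
    {u : G} (hu : u ^ p = 1) (S : Finset G) (hSp : ∀ s ∈ S, s ^ p = 1)
    (hS : ∀ s ∈ S, ∀ t ∈ S, Commute s t) (hSu : ∀ s ∈ S, Commute u s)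
    (hconj : ∀ x, Commute u x → ∀ s ∈ S, x * s * x⁻¹ ∈ S)
    (hbu : ∃ g, Commute u g ∧ b.coeff g ≠ 0) :
    ∃ g, (∀ s ∈ S, Commute s g) ∧ b.coeff g ≠ 0 := by
  classical
  by_contra! hcon
  obtain ⟨g, hg, hbg⟩ := hbu
  have hinv := conjInvariant_of_central hb
  set Q := Subgroup.zpowers u
  set e := brauer (Q : Set G) b with he
  have hQ : IsPGroup p Q := isPGroup_zpowers hu
  have hee : e * e = e := by rw [he, ← brauer_mul p hQ (hinv _) (hinv _), hbi]
  have he0 : e ≠ 0 := fun h => hbg (by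
    rw [← coeff_brauer_of_mem (R := Q) b (mem_centralizer_zpowers_iff.mpr hg), ← he, h]; rfl)
  have heC : ConjInvariant (Subgroup.centralizer (Q : Set G)) e :=
    (hinv _).brauer fun s hs x => by
      rw [(Subgroup.centralizer (Q : Set G)).mul_mem_cancel_right (inv_mem hs),
        (Subgroup.centralizer (Q : Set G)).mul_mem_cancel_left hs]
  have hSC : ∀ s ∈ S, s ∈ Subgroup.centralizer (Q : Set G) := fun s hs =>
    mem_centralizer_zpowers_iff.mpr (hSu s hs)
  obtain ⟨m, hm0, hem, hSm⟩ := exists_ne_zero_fixed_of_nilpotent he0 hee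
    (S.image fun s => (single s 1 : MonoidAlgebra k G))
    (Finset.forall_mem_image.mpr fun s hs => isNilpotent_single_sub_one p (hSp s hs))
    (Finset.forall_mem_image.mpr fun s hs => commute_single_of_conjInvariant heC (hSC s hs))
    (Finset.forall_mem_image.mpr fun s hs => Finset.forall_mem_image.mpr fun t ht =>
      single_commute_single (hS s hs t ht) (Commute.one_right _))
  have hSm' : ∀ s ∈ (S : Set G), single s 1 * m = m := fun s hs =>
    hSm _ (Finset.mem_image_of_mem _ hs)
  set V := Subgroup.closure (S : Set G)
  have hVC : V ≤ Subgroup.centralizer (Q : Set G) := (Subgroup.closure_le _).mpr hSC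
  have hVn : ∀ x, Commute u x → ∀ v ∈ V, x * v * x⁻¹ ∈ V := fun x hx v hv => by
    have h1 : V ≤ V.comap (MulAut.conj x).toMonoidHom :=
      (Subgroup.closure_le _).mpr fun s hs => Subgroup.subset_closure (hconj x hx s hs)
    exact h1 hv
  refine hm0 ?_
  ext y
  rw [← hem, coeff_mul_eq_sum]
  -- `V` acts on `x` by conjugation. If `x` commutes with `u` it normalizes `V`, so conjugation
  -- changes `x⁻¹ * y` only by a left factor in `V`, which `m` does not see. On `C(V)` the
  -- coefficients of `e` vanish by `hcon`.
  refine IsPGroup.sum_eq_zero_of_conj p (isPGroup_closure_of_commute hSp hS) _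
    (fun r hr x => ?_) fun x hx => ?_
  · rw [heC r (hVC hr)]
    by_cases hx : Commute u x
    · have h1 : (r * x * r⁻¹)⁻¹ * y = r * ((x⁻¹ * r⁻¹ * x⁻¹⁻¹) * (x⁻¹ * y)) := by group
      rw [h1, coeff_mul_of_mem_closure hSm' hr,
        coeff_mul_of_mem_closure hSm' (hVn _ hx.inv_right _ (inv_mem hr))]
    · rw [he, coeff_brauer_of_notMem _ (mt mem_centralizer_zpowers_iff.mp hx), zero_mul, zero_mul]
  · by_cases hxu : Commute u x
    · rw [he, coeff_brauer_of_mem _ (mem_centralizer_zpowers_iff.mpr hxu), hcon x, zero_mul]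
      exact fun s hs => Subgroup.mem_centralizer_iff.mp hx s (Subgroup.subset_closure hs)
    · rw [he, coeff_brauer_of_notMem _ (mt mem_centralizer_zpowers_iff.mp hxu), zero_mul]

/-- Modulo `(c - 1)²` the sum is `α + β (c - 1)` with `α = ∑ a i` and `β = ∑ a i * i ≠ 0`. If `e (c
- 1)^(m+2) = 0`, multiplying the relation by `(c - 1)^(m+1)` and by `(c - 1)^m` gives `α e (c -
1)^(m+1) = 0` and `α e (c - 1)^m + β e (c - 1)^(m+1) = 0`. Whether or not `α = 0`, the exponent
drops by one. -/
theorem mul_sub_one_eq_zero_of_mul_sum_eq_zero {A : Type*} [Ring A] [Algebra k A] {e c : A}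
    {n N : ℕ} {a : ℕ → k} (hn : e * (c - 1) ^ n = 0) (ha : ∑ i ∈ Finset.range N, a i * (i : k) ≠ 0)
    (hT : e * ∑ i ∈ Finset.range N, a i • c ^ i = 0) (hec : Commute e c) : e * (c - 1) = 0 := by
  have key : ∀ m, e * (c - 1) ^ (m + 2) = 0 → e * (c - 1) ^ (m + 1) = 0 := fun m hm => by
    have h2 : ∀ i : ℕ, e * (c - 1) ^ (m + 1) * c ^ i = e * (c - 1) ^ (m + 1) := fun i => by
      induction i with
      | zero => simp
      | succ i ih =>
        rw [pow_succ c, ← mul_assoc, ih, ← sub_eq_zero, ← mul_sub_one, mul_assoc, ← pow_succ, hm]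
    have h1 : ∀ i : ℕ, e * (c - 1) ^ m * c ^ i =
        e * (c - 1) ^ m + (i : k) • (e * (c - 1) ^ (m + 1)) := fun i => by
      induction i with
      | zero => simp
      | succ i ih =>
        have h3 := h2 1
        have h4 : e * (c - 1) ^ m * c = e * (c - 1) ^ m + e * (c - 1) ^ (m + 1) := by
          rw [pow_succ, ← mul_assoc, mul_sub_one, add_sub_cancel]
        rw [pow_one] at h3
        rw [pow_succ, ← mul_assoc, ih, add_mul, smul_mul_assoc, h3, h4]
        push_cast
        rw [add_smul, one_smul]
        abel
    have hT' : ∀ j, ∑ i ∈ Finset.range N, a i • (e * (c - 1) ^ j * c ^ i) = 0 := fun j => by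
      have hc : Commute e ((c - 1) ^ j) := (hec.sub_right (Commute.one_right e)).pow_right j
      have h5 := congrArg ((c - 1) ^ j * ·) hT
      simp only [mul_zero, Finset.mul_sum, mul_smul_comm] at h5
      simpa only [hc.eq, mul_assoc] using h5
    have hA := hT' (m + 1)
    have hB := hT' m
    simp only [h2] at hA
    simp only [h1, smul_add, smul_smul, Finset.sum_add_distrib] at hB
    rw [← Finset.sum_smul] at hA
    rw [← Finset.sum_smul, ← Finset.sum_smul] at hB
    rcases smul_eq_zero.mp hA with h | h
    · rw [h, zero_smul, zero_add] at hB
      exact (smul_eq_zero.mp hB).resolve_left ha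
    · exact h
  have hall : ∀ m, e * (c - 1) ^ (m + 1) = 0 → e * (c - 1) = 0 := fun m => by
    induction m with
    | zero => simp
    | succ m ih => exact fun h => ih (key m h)
  exact hall n (by rw [pow_succ, ← mul_assoc, hn, zero_mul])

/-- Otherwise `c e = e`, so the terms of the convolution `e * e` are constant on the orbits of left
translation by `⟨c⟩`. These are free, whence `e = e * e = 0`. -/
theorem mul_sum_ne_zero [Fintype G] (p : ℕ) [Fact p.Prime] [CharP k p] {c : G}
    (hc : orderOf c = p) {e : MonoidAlgebra k G} (he0 : e ≠ 0) (hee : e * e = e)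
    (hsupp : ∀ x, e.coeff x ≠ 0 → Commute c x) (hec : Commute e (single c 1)) {N : ℕ} {a : ℕ → k}
    (ha : ∑ i ∈ Finset.range N, a i * (i : k) ≠ 0) :
    e * ∑ i ∈ Finset.range N, a i • (single c 1 : MonoidAlgebra k G) ^ i ≠ 0 := by
  intro hT
  have hcp : c ^ p = 1 := by rw [← hc, pow_orderOf_eq_one]
  obtain ⟨n, hn⟩ := isNilpotent_single_sub_one (k := k) p hcp
  have h1 := mul_sub_one_eq_zero_of_mul_sum_eq_zero (n := n) (by rw [hn, mul_zero]) ha hT hec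
  have h2 : ∀ s ∈ ({c} : Set G), single s 1 * e = e := by
    rintro s rfl
    rw [← hec.eq, ← sub_eq_zero, ← mul_sub_one, h1]
  have h3 : ∀ r ∈ Subgroup.zpowers c, ∀ x, e.coeff (r * x) = e.coeff x := fun r hr x =>
    coeff_mul_of_mem_closure h2 (by rwa [← Subgroup.zpowers_eq_closure]) x
  refine he0 ?_
  rw [← hee]
  ext y
  rw [coeff_mul_eq_sum]
  refine IsPGroup.sum_eq_zero p (isPGroup_zpowers hcp) _ (fun r x => ?_) fun x hx => ?_
  · change e.coeff (r.1 * x) * e.coeff ((r.1 * x)⁻¹ * y) = _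
    rw [h3 _ r.2]
    by_cases hx : e.coeff x = 0
    · rw [hx, zero_mul, zero_mul]
    · have h4 : Commute r.1 x⁻¹ := by
        obtain ⟨i, hi⟩ := r.2
        rw [← hi]
        exact (hsupp x hx).inv_right.zpow_left i
      rw [mul_inv_rev, ← h4.inv_left.eq, mul_assoc, h3 _ (inv_mem r.2)]
  · have h5 : c * x = x := hx ⟨c, Subgroup.mem_zpowers c⟩
    rw [mul_eq_right] at h5
    rw [h5, orderOf_one] at hc
    exact absurd hc.symm (Fact.out : p.Prime).ne_one

end BrauerSupport

/-! ### Cocycles induced from the centralizer of an element of order `p`. -/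

section GroupCocycle

variable {k : Type u} [Field k] {G : Type v} [Group G]

open MonoidAlgebra

/-- The linear endomorphism `g ↦ δ(g) g` of the group algebra attached to `δ : G → kG`. -/
noncomputable def cocycleMap (δ : G → MonoidAlgebra k G) :
    MonoidAlgebra k G →ₗ[k] MonoidAlgebra k G :=
  (Finsupp.linearCombination k fun g => δ g * single g 1) ∘ₗ (coeffLinearEquiv k).toLinearMap

theorem cocycleMap_single (δ : G → MonoidAlgebra k G) (g : G) (r : k) :
    cocycleMap δ (single g r) = r • (δ g * single g 1) :=
  Finsupp.linearCombination_single k r g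

theorem cocycleMap_mul {δ : G → MonoidAlgebra k G}
    (hδ : ∀ g h, δ (g * h) = δ g + single g 1 * δ h * single g⁻¹ 1) (x y : MonoidAlgebra k G) :
    cocycleMap δ (x * y) = x * cocycleMap δ y + cocycleMap δ x * y := by
  induction x using MonoidAlgebra.induction_linear with
  | zero => simp
  | add x x' hx hx' => rw [add_mul, map_add, map_add, hx, hx', add_mul, add_mul]; abel
  | single g r =>
    induction y using MonoidAlgebra.induction_linear with
    | zero => simp
    | add y y' hy hy' => rw [mul_add, map_add, map_add, hy, hy', mul_add, mul_add]; abel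
    | single h s =>
      have h1 : (single g r : MonoidAlgebra k G) = r • single g 1 := by simp
      have h2 : (single h s : MonoidAlgebra k G) = s • single h 1 := by simp
      rw [single_mul_single, cocycleMap_single, cocycleMap_single, cocycleMap_single, hδ, h1, h2]
      have h3 : (single g⁻¹ 1 : MonoidAlgebra k G) * single (g * h) 1 = single h 1 := by
        simp [single_mul_single]
      have h4 : (single g 1 : MonoidAlgebra k G) * single h 1 = single (g * h) 1 := by
        simp [single_mul_single]
      rw [add_mul, mul_assoc _ _ (single (g * h) 1), h3, ← h4]
      simp only [smul_mul_assoc, mul_smul_comm, smul_smul, mul_assoc, smul_add, mul_comm s r]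
      rw [add_comm]

/-- A 1-cocycle of `G` in `kG` whose product with a central idempotent `b` is not a coboundary gives
a nonzero first Hochschild cohomology group of `kGb`. -/
theorem nontrivial_hochschildCohomology_corner_of_cocycle {k : Type u} {G : Type} [Field k]
    [Group G] {δ : G → MonoidAlgebra k G} {b : MonoidAlgebra k G}
    (hδ : ∀ g h, δ (g * h) = δ g + single g 1 * δ h * single g⁻¹ 1)
    (hb : IsIdempotentElem b) (hc : b ∈ Subring.center (MonoidAlgebra k G))
    (hn : ¬ ∃ y, ∀ g, b * δ g = y - single g 1 * y * single g⁻¹ 1) :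
    Nontrivial (HochschildCohomology k hb.Corner 1) := by
  have hc' : ∀ a, b * a = a * b := fun a => (Subring.mem_center_iff.mp hc a).symm
  refine nontrivial_hochschildCohomology_corner_of_derivation (cocycleMap δ) (cocycleMap_mul hδ)
    hb hc' ?_
  rintro ⟨y, hy⟩
  refine hn ⟨-y, fun g => ?_⟩
  have h1 := congrArg (· * single g⁻¹ 1) (hy (single g 1))
  have h2 : (single g 1 : MonoidAlgebra k G) * single g⁻¹ 1 = 1 := by
    simp [single_mul_single, one_def]
  simp only [cocycleMap_single, one_smul, ← hc'] at h1
  rw [mul_assoc, mul_assoc, h2, mul_one, sub_mul, mul_assoc y, h2, mul_one] at h1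
  rw [h1]
  simp only [mul_neg, neg_mul]
  abel

theorem mem_zpowers_of_orderOf_prime {p : ℕ} [Fact p.Prime] {c z : G} (hc : orderOf c = p)
    (hz : z ∈ Subgroup.zpowers c) (hz1 : z ≠ 1) : c ∈ Subgroup.zpowers z := by
  have h1 : Nat.card (Subgroup.zpowers c) = p := by rw [Nat.card_zpowers, hc]
  obtain ⟨i, hi⟩ := mem_zpowers_of_prime_card (g := (⟨z, hz⟩ : Subgroup.zpowers c))
    (g' := ⟨c, Subgroup.mem_zpowers c⟩) h1 (fun h => hz1 (congrArg Subtype.val h))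
  exact ⟨i, congrArg Subtype.val hi⟩

/-- Choose `t` at one point of each orbit of conjugation by `⟨c⟩` and transport it. Since `p` is
prime, the orbit of an element not commuting with `c` is free, so transport is unambiguous there.
This equivariance makes the induced cocycle at `c` vanish outside `C(c)`. -/
theorem exists_equivariant_conjugators {p : ℕ} [Fact p.Prime] {c : G} (hc : orderOf c = p) :
    ∃ t : G → G, (∀ y, IsConj c y → t y * c * (t y)⁻¹ = y) ∧
      ∀ y, ¬ Commute c y → t (c * y * c⁻¹) = c * t y := by
  let s : Setoid G :=
    { r := fun x y => ∃ q ∈ Subgroup.zpowers c, q * x * q⁻¹ = y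
      iseqv :=
        { refl := fun x => ⟨1, one_mem _, by simp⟩
          symm := by
            rintro x _ ⟨q, hq, rfl⟩
            exact ⟨q⁻¹, inv_mem hq, by group⟩
          trans := by
            rintro x _ _ ⟨q, hq, rfl⟩ ⟨q', hq', rfl⟩
            exact ⟨q' * q, mul_mem hq' hq, by group⟩ } }
  let rep : G → G := fun y => (Quotient.mk s y).out
  have hrep : ∀ y, ∃ q ∈ Subgroup.zpowers c, q * rep y * q⁻¹ = y := fun y => Quotient.mk_out y
  choose q hq hqy using hrep
  have hex : ∀ y, ∃ t, IsConj c y → t * c * t⁻¹ = y := fun y => by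
    by_cases h : IsConj c y
    · obtain ⟨t, ht⟩ := isConj_iff.mp h
      exact ⟨t, fun _ => ht⟩
    · exact ⟨1, fun h' => absurd h' h⟩
  choose t₀ ht₀ using hex
  refine ⟨fun y => q y * t₀ (rep y), fun y hy => ?_, fun y hy => ?_⟩
  · have h1 : IsConj c (rep y) := hy.trans (isConj_iff.mpr ⟨q y, hqy y⟩).symm
    calc q y * t₀ (rep y) * c * (q y * t₀ (rep y))⁻¹
        = q y * (t₀ (rep y) * c * (t₀ (rep y))⁻¹) * (q y)⁻¹ := by group
      _ = y := by rw [ht₀ _ h1, hqy]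
  · have h1 : rep (c * y * c⁻¹) = rep y := by
      have : Quotient.mk s (c * y * c⁻¹) = Quotient.mk s y :=
        (Quotient.sound (s := s) ⟨c, Subgroup.mem_zpowers c, rfl⟩).symm
      simp only [rep, this]
    have h2 := hqy (c * y * c⁻¹)
    rw [h1] at h2
    by_contra hne
    simp only [h1] at hne
    -- `z` measures the failure of equivariance; it fixes `rep y`, and if nontrivial it generates
    -- `⟨c⟩`, making `c` commute with `y`.
    set z := (c * q y)⁻¹ * q (c * y * c⁻¹) with hz
    have hz1 : z ≠ 1 := fun h => hne (by
      rw [hz, inv_mul_eq_one] at h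
      rw [← h, mul_assoc])
    have hzc : z ∈ Subgroup.zpowers c :=
      mul_mem (inv_mem (mul_mem (Subgroup.mem_zpowers c) (hq y))) (hq _)
    have hzr : Commute z (rep y) := by
      have h3 : q (c * y * c⁻¹) * rep y * (q (c * y * c⁻¹))⁻¹ =
          c * q y * rep y * (c * q y)⁻¹ := by
        rw [h2]
        nth_rewrite 1 [← hqy y]
        group
      have h4 : z * rep y * z⁻¹ = rep y := by
        calc z * rep y * z⁻¹ = (c * q y)⁻¹ *
              (q (c * y * c⁻¹) * rep y * (q (c * y * c⁻¹))⁻¹) * (c * q y) := by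
              rw [hz]; group
          _ = rep y := by rw [h3]; group
      exact mul_inv_eq_iff_eq_mul.mp h4
    obtain ⟨i, hi⟩ := mem_zpowers_of_orderOf_prime hc hzc hz1
    have hcr : Commute c (rep y) := by rw [← hi]; exact hzr.zpow_left i
    obtain ⟨j, hj⟩ := hq y
    have hcq : Commute c (q y) := by rw [← hj]; exact (Commute.refl c).zpow_right j
    refine hy ?_
    rw [← hqy y]
    exact (hcq.mul_right hcr).mul_right hcq.inv_right

open Classical in
/-- The 1-cocycle of `G` in `kG` obtained from a homomorphism `f` on the centralizer of `c`; the
element `t y` conjugates `c` to `y`. -/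
noncomputable def centralizerCocycle [Fintype G] (c : G) (t : G → G) (f : G → k) (g : G) :
    MonoidAlgebra k G :=
  ofCoeff (Finsupp.equivFunOnFinite.symm fun y =>
    if IsConj c y then f ((t y)⁻¹ * g * t (g⁻¹ * y * g)) else 0)

theorem coeff_centralizerCocycle [Fintype G] (c : G) (t : G → G) (f : G → k) (g y : G)
    (hy : IsConj c y) : (centralizerCocycle c t f g).coeff y =
      f ((t y)⁻¹ * g * t (g⁻¹ * y * g)) := by
  classical exact if_pos hy

theorem coeff_centralizerCocycle_of_not [Fintype G] (c : G) (t : G → G) (f : G → k) (g y : G)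
    (hy : ¬ IsConj c y) : (centralizerCocycle c t f g).coeff y = 0 := by
  classical exact if_neg hy

/-- The argument of `f` for `g * h` at `y` is the product of those for `g` at `y` and for `h` at
`g⁻¹ * y * g`, and both lie in `C(c)`. -/
theorem centralizerCocycle_mul [Fintype G] {c : G} {t : G → G} {f : G → k}
    (ht : ∀ y, IsConj c y → t y * c * (t y)⁻¹ = y)
    (hf : ∀ x y, Commute c x → Commute c y → f (x * y) = f x + f y) (g h : G) :
    centralizerCocycle c t f (g * h) = centralizerCocycle c t f g +
      single g 1 * centralizerCocycle c t f h * single g⁻¹ 1 := by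
  ext y
  have hcomm : ∀ g y, IsConj c y → Commute c ((t y)⁻¹ * g * t (g⁻¹ * y * g)) := fun g y hy => by
    have h1 := ht y hy
    have h2 := ht (g⁻¹ * y * g) (hy.trans (isConj_iff.mpr ⟨g⁻¹, by group⟩))
    have h3 : t (g⁻¹ * y * g) * c = g⁻¹ * y * g * t (g⁻¹ * y * g) := mul_inv_eq_iff_eq_mul.mp h2
    have h4 : t y * c = y * t y := mul_inv_eq_iff_eq_mul.mp h1
    have h5 : c * (t y)⁻¹ = (t y)⁻¹ * y := by
      rw [eq_inv_mul_iff_mul_eq, ← mul_assoc, h4, mul_inv_cancel_right]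
    calc c * ((t y)⁻¹ * g * t (g⁻¹ * y * g)) = c * (t y)⁻¹ * g * t (g⁻¹ * y * g) := by group
      _ = (t y)⁻¹ * g * (g⁻¹ * y * g * t (g⁻¹ * y * g)) := by rw [h5]; group
      _ = _ := by rw [← h3]; group
  have hval : (single g 1 * centralizerCocycle c t f h * single g⁻¹ 1 : MonoidAlgebra k G).coeff y =
      (centralizerCocycle c t f h).coeff (g⁻¹ * y * g) := by
    simp [mul_assoc]
  have hiff : IsConj c y ↔ IsConj c (g⁻¹ * y * g) :=
    ⟨fun hy => hy.trans (isConj_iff.mpr ⟨g⁻¹, by group⟩),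
      fun hy => hy.trans (isConj_iff.mpr ⟨g, by group⟩)⟩
  rw [coeff_add, Finsupp.add_apply, hval]
  by_cases hy : IsConj c y
  · rw [coeff_centralizerCocycle _ _ _ _ _ hy, coeff_centralizerCocycle _ _ _ _ _ hy,
      coeff_centralizerCocycle _ _ _ _ _ (hiff.mp hy), ← hf _ _ (hcomm g y hy)
        (hcomm h _ (hiff.mp hy))]
    congr 1
    simp only [mul_inv_rev, mul_assoc, mul_inv_cancel_left]
  · rw [coeff_centralizerCocycle_of_not _ _ _ _ _ hy, coeff_centralizerCocycle_of_not _ _ _ _ _ hy,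
      coeff_centralizerCocycle_of_not _ _ _ _ _ (mt hiff.mpr hy), add_zero]

/-- A homomorphism `f` on the centralizer of an element `c` of order `p` that is nonzero on `c` and
vanishes on the conjugates of `c` which do not generate `⟨c⟩` gives a nonzero first Hochschild
cohomology group of `kGb` for every central idempotent `b` with nonzero Brauer image at `⟨c⟩`. -/
theorem nontrivial_hochschildCohomology_corner_of_centralizer_hom {k : Type u} {G : Type} [Field k]
    [Group G] [Fintype G] (p : ℕ) [Fact p.Prime] [CharP k p] {c : G} (hc : orderOf c = p) {f : G → k}
    (hf : ∀ x y, Commute c x → Commute c y → f (x * y) = f x + f y) (hfc : f c = 1)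
    (hf0 : ∀ d, IsConj c d → Commute c d → f d ≠ 0 → c ∈ Subgroup.zpowers d)
    (hpow : ∀ i, 0 < i → i < p → IsConj c (c ^ i))
    {b : MonoidAlgebra k G} (hb : IsIdempotentElem b)
    (hbc : b ∈ Subring.center (MonoidAlgebra k G)) (hbg : ∃ g, Commute c g ∧ b.coeff g ≠ 0) :
    Nontrivial (HochschildCohomology k hb.Corner 1) := by
  have hp : p.Prime := Fact.out
  have hcp : c ^ p = 1 := by rw [← hc, pow_orderOf_eq_one]
  have hQ : IsPGroup p (Subgroup.zpowers c) := isPGroup_zpowers hcp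
  obtain ⟨t, ht, htc⟩ := exists_equivariant_conjugators hc
  have hf1 : f 1 = 0 := by
    simpa using hf 1 1 (Commute.one_right c) (Commute.one_right c)
  have hfpow : ∀ x, Commute c x → ∀ i : ℕ, f (x ^ i) = i * f x := fun x hx i => by
    induction i with
    | zero => simp [hf1]
    | succ i ih => rw [pow_succ, hf _ _ (hx.pow_right i) hx, ih]; push_cast; ring
  set δ := centralizerCocycle c t f with hδ
  -- the value of the cocycle at `c`
  have hδ0 : ∀ y, ¬ Commute c y → (δ c).coeff y = 0 := fun y hy => by
    by_cases hyc : IsConj c y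
    · have h1 : ¬ Commute c (c⁻¹ * y * c) := fun h => hy (by
        have h2 := ((Commute.refl c).mul_right h).mul_right (Commute.refl c).inv_right
        have h3 : c * (c⁻¹ * y * c) * c⁻¹ = y := by group
        rwa [h3] at h2)
      have h2 := htc _ h1
      rw [show c * (c⁻¹ * y * c) * c⁻¹ = y by group] at h2
      rw [hδ, coeff_centralizerCocycle _ _ _ _ _ hyc, mul_assoc, ← h2, inv_mul_cancel, hf1]
    · exact coeff_centralizerCocycle_of_not _ _ _ _ _ hyc
  have hδ1 : ∀ y, IsConj c y → Commute c y → (δ c).coeff y = f ((t y)⁻¹ * c * t y) :=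
    fun y hy hcy => by
      rw [hδ, coeff_centralizerCocycle _ _ _ _ _ hy, mul_assoc c⁻¹, ← hcy.eq,
        inv_mul_cancel_left]
  have hd : ∀ y, IsConj c y → Commute c y → Commute c ((t y)⁻¹ * c * t y) := fun y hy hcy => by
    rw [← Commute.conj_iff (t y), ht y hy,
      show t y * ((t y)⁻¹ * c * t y) * (t y)⁻¹ = c by group]
    exact hcy.symm
  -- With `d = (t y)⁻¹ * c * t y`, `hf0` gives `c = d ^ i`; conjugating by `t y` gives `y = c ^ i`.
  have hδz : ∀ y, (δ c).coeff y ≠ 0 → y ∈ Subgroup.zpowers c := fun y hy => by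
    have hcy : Commute c y := by_contra fun h => hy (hδ0 y h)
    have hyc : IsConj c y := by_contra fun h => hy (coeff_centralizerCocycle_of_not _ _ _ _ _ h)
    rw [hδ1 y hyc hcy] at hy
    obtain ⟨i, hi⟩ := hf0 _ (isConj_iff.mpr ⟨(t y)⁻¹, by group⟩) (hd y hyc hcy) hy
    refine ⟨i, ?_⟩
    rw [← ht y hyc]
    simp only at hi ⊢
    nth_rewrite 2 [← hi]
    rw [← conj_zpow]
    congr 1
    group
  -- For `y = c ^ i` the same `d` satisfies `d ^ i = c`, so `i * f d = f c = 1`.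
  have hδi : ∀ i ∈ Finset.range p, (δ c).coeff (c ^ i) * (i : k) = if i = 0 then 0 else 1 := by
    intro i hi
    split_ifs with h0
    · rw [h0, Nat.cast_zero, mul_zero]
    have hyc := hpow i (Nat.pos_of_ne_zero h0) (Finset.mem_range.mp hi)
    have hcy : Commute c (c ^ i) := (Commute.refl c).pow_right i
    rw [hδ1 _ hyc hcy, mul_comm, ← hfpow _ (hd _ hyc hcy), ← hfc]
    congr 1
    have h1 := ht _ hyc
    have h2 := conj_pow (a := (t (c ^ i))⁻¹) (b := c) (i := i)
    rw [inv_inv] at h2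
    rw [h2]
    nth_rewrite 2 [← h1]
    group
  -- The sum is `p - 1`, that is, `-1` in `k`.
  have hsum : ∑ i ∈ Finset.range p, (δ c).coeff (c ^ i) * (i : k) ≠ 0 := by
    rw [Finset.sum_congr rfl hδi]
    obtain ⟨q, hq⟩ := Nat.exists_eq_succ_of_ne_zero hp.ne_zero
    rw [hq, Finset.sum_range_succ']
    simp only [Nat.add_eq_zero_iff, one_ne_zero, and_false, if_false, if_true, Finset.sum_const,
      Finset.card_range, nsmul_eq_mul, mul_one, add_zero]
    intro h
    rw [CharP.cast_eq_zero_iff k p] at h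
    have h1 : p ∣ 1 := (Nat.dvd_add_right h).mp (dvd_of_eq hq)
    exact hp.one_lt.not_ge (Nat.le_of_dvd one_pos h1)
  have hT : δ c =
      ∑ i ∈ Finset.range p, (δ c).coeff (c ^ i) • (single c 1 : MonoidAlgebra k G) ^ i := by
    classical
    ext y
    rw [coeff_sum, Finsupp.finsetSum_apply]
    simp only [single_pow, one_pow, coeff_smul_apply, coeff_single, Finsupp.single_apply, smul_eq_mul,
      mul_ite, mul_one, mul_zero]
    by_cases hy : y ∈ Subgroup.zpowers c
    · rw [mem_zpowers_iff_mem_range_orderOf, hc] at hy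
      obtain ⟨j, hj, rfl⟩ := Finset.mem_image.mp hy
      rw [Finset.sum_eq_single j, if_pos rfl]
      · intro i hi hij
        refine if_neg fun h => hij (pow_injOn_Iio_orderOf (x := c) ?_ ?_ h)
        · simpa [hc] using hi
        · simpa [hc] using hj
      · exact fun h => absurd hj h
    · rw [not_not.mp (mt (hδz y) hy)]
      refine (Finset.sum_eq_zero fun i _ => if_neg fun h => hy ?_).symm
      rw [← h]
      exact pow_mem (Subgroup.mem_zpowers c) i
  have hinv := conjInvariant_of_central hbc
  set e := brauer (Subgroup.zpowers c : Set G) b with he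
  have hee : e * e = e := by rw [he, ← brauer_mul p hQ (hinv _) (hinv _), hb]
  obtain ⟨g, hcg, hbg⟩ := hbg
  have he0 : e ≠ 0 := fun h => hbg (by
    rw [← coeff_brauer_of_mem (R := Subgroup.zpowers c) b (mem_centralizer_zpowers_iff.mpr hcg),
      ← he, h]; rfl)
  have hsupp : ∀ x, e.coeff x ≠ 0 → Commute c x := fun x hx => by_contra fun h =>
    hx (coeff_brauer_of_notMem b (mt mem_centralizer_zpowers_iff.mp h))
  have hec : Commute e (single c 1) :=
    commute_single_of_conjInvariant (hinv _).brauer_self (Subgroup.mem_zpowers c)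
  have hne : e * δ c ≠ 0 := by
    rw [hT]
    exact mul_sum_ne_zero p hc he0 hee hsupp hec hsum
  refine nontrivial_hochschildCohomology_corner_of_cocycle (centralizerCocycle_mul ht hf) hb hbc ?_
  rintro ⟨y, hy⟩
  refine hne ?_
  have hδb : brauer (Subgroup.zpowers c : Set G) (δ c) = δ c := by
    ext x
    by_cases hx : Commute c x
    · rw [coeff_brauer_of_mem _ (mem_centralizer_zpowers_iff.mpr hx)]
    · rw [coeff_brauer_of_notMem _ (mt mem_centralizer_zpowers_iff.mp hx), hδ0 x hx]
  have hδinv : ConjInvariant (Subgroup.zpowers c : Set G) (δ c) := by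
    rintro r ⟨i, rfl⟩ x
    by_cases hx : Commute c x
    · rw [((hx.zpow_left i)).eq, mul_inv_cancel_right]
    · rw [hδ0 x hx, hδ0 _ fun h => hx ?_]
      have h1 : Commute c (c ^ i) := (Commute.refl c).zpow_right i
      have h2 := (h1.inv_right.mul_right h).mul_right h1
      rwa [show (c ^ i)⁻¹ * (c ^ i * x * (c ^ i)⁻¹) * c ^ i = x by group] at h2
  -- At an element commuting with `c`, the coefficients of `y` and of `c y c⁻¹` agree.
  rw [← hδb, he, ← brauer_mul p hQ (hinv _) hδinv, hy c]
  ext x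
  by_cases hx : Commute c x
  · rw [coeff_brauer_of_mem _ (mem_centralizer_zpowers_iff.mpr hx)]
    have h1 : c⁻¹ * (x * c) = x := by rw [← hx.eq, inv_mul_cancel_left]
    simp [h1, mul_assoc]
  · rw [coeff_brauer_of_notMem _ (mt mem_centralizer_zpowers_iff.mp hx)]; rfl

end GroupCocycle

/-! ### The homomorphism to `k` on the centralizer of a `p`-cycle. -/

namespace Equiv.Perm

variable {α : Type*} [Fintype α]

/-- The exponent `i` such that `h` acts on the point `a` as the power `c ^ i`. -/
noncomputable def cycleExponent (k : Type*) [Field k] (c : Perm α) (a : α) (h : Perm α) : k :=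
  open Classical in if hex : ∃ i : ℕ, (c ^ i) a = h a then (hex.choose : k) else 0

variable {k : Type*} [Field k] {p : ℕ} [CharP k p] {c : Perm α} {a : α}

/-- The order of `c` is the characteristic, so exponents are well defined in `k`. -/
theorem IsCycle.natCast_eq_natCast_iff (hc : c.IsCycle) (hp : orderOf c = p) (ha : c a ≠ a)
    (i j : ℕ) : (i : k) = j ↔ (c ^ i) a = (c ^ j) a := by
  rw [CharP.natCast_eq_natCast k p, ← hp, ← pow_eq_pow_iff_modEq]
  exact ⟨fun h => by rw [h], fun h => hc.pow_eq_pow_iff.mpr ⟨a, ha, h⟩⟩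

theorem IsCycle.cycleExponent_eq (hc : c.IsCycle) (hp : orderOf c = p) (ha : c a ≠ a)
    {h : Perm α} {i : ℕ} (hi : (c ^ i) a = h a) : cycleExponent k c a h = i := by
  have hex : ∃ i : ℕ, (c ^ i) a = h a := ⟨i, hi⟩
  rw [cycleExponent, dif_pos hex, hc.natCast_eq_natCast_iff (k := k) hp ha, hex.choose_spec, hi]

theorem IsCycle.exists_pow_eq_of_commute (hc : c.IsCycle) (ha : c a ≠ a) {h : Perm α}
    (hch : Commute c h) : ∃ i : ℕ, (c ^ i) a = h a := by
  refine hc.exists_pow_eq ha ?_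
  rw [← mul_apply, hch.eq, mul_apply]
  exact fun h' => ha (h.injective h')

theorem IsCycle.cycleExponent_mul (hc : c.IsCycle) (hp : orderOf c = p) (ha : c a ≠ a)
    (x y : Perm α) (hx : Commute c x) (hy : Commute c y) :
    cycleExponent k c a (x * y) = cycleExponent k c a x + cycleExponent k c a y := by
  obtain ⟨i, hi⟩ := hc.exists_pow_eq_of_commute ha hx
  obtain ⟨j, hj⟩ := hc.exists_pow_eq_of_commute ha hy
  have h : (c ^ (i + j)) a = (x * y) a := by
    rw [add_comm, pow_add, mul_apply, hi, mul_apply, ← hj, ← mul_apply, ← mul_apply,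
      (hx.pow_left j).eq]
  rw [hc.cycleExponent_eq hp ha hi, hc.cycleExponent_eq hp ha hj, hc.cycleExponent_eq hp ha h,
    Nat.cast_add]

/-- Commuting with `c`, `d` acts on the whole cycle as one power `c ^ j`, here without fixed points.
As a conjugate of `c` it moves no further points, so `d = c ^ j ≠ 1`. -/
theorem IsCycle.mem_zpowers_of_cycleExponent_ne_zero [DecidableEq α] [Fact p.Prime] (hc : c.IsCycle)
    (hp : orderOf c = p) (ha : c a ≠ a) {d : Perm α} (hcd : IsConj c d) (hd : Commute c d)
    (hne : cycleExponent k c a d ≠ 0) : c ∈ Subgroup.zpowers d := by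
  obtain ⟨j, hj⟩ := hc.exists_pow_eq_of_commute ha hd
  rw [hc.cycleExponent_eq hp ha hj] at hne
  have hda : d a ≠ a := fun h => hne (by
    rw [← Nat.cast_zero, hc.natCast_eq_natCast_iff hp ha, hj, h]; rfl)
  have hpow : ∀ x, c x ≠ x → d x = (c ^ j) x ∧ d x ≠ x := fun x hx => by
    obtain ⟨m, rfl⟩ := hc.exists_pow_eq ha hx
    rw [← mul_apply, ← mul_apply, ← (hd.pow_left m).eq, ← ((Commute.refl c).pow_pow m j).eq,
      mul_apply, mul_apply, hj]
    exact ⟨rfl, fun h => hda ((c ^ m).injective h)⟩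
  have hsub : c.support ⊆ d.support := fun x hx => mem_support.mpr (hpow x (mem_support.mp hx)).2
  have hcard : d.support.card = c.support.card := by
    obtain ⟨t, rfl⟩ := _root_.isConj_iff.mp hcd
    exact card_support_conj
  have hsupp := Finset.eq_of_subset_of_card_le hsub hcard.le
  have hdc : d = c ^ j := by
    ext x
    by_cases hx : c x = x
    · have h1 : d x = x := by
        rw [← notMem_support, ← hsupp, notMem_support, hx]
      rw [h1, pow_apply_eq_self_of_apply_eq_self hx]
    · rw [(hpow x hx).1]
  rw [hdc]
  refine mem_zpowers_of_orderOf_prime hp (pow_mem (Subgroup.mem_zpowers c) j) fun h => hda ?_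
  rw [hdc, h]; rfl

theorem IsCycle.isConj_pow [DecidableEq α] (hc : c.IsCycle) (hp : (orderOf c).Prime) {i : ℕ}
    (hi : 0 < i) (hip : i < orderOf c) : IsConj c (c ^ i) := by
  rw [hc.isConj_iff (hc.isCycle_pow_pos_of_lt_prime_order hp i hi hip),
    hc.support_pow_of_pos_of_lt_orderOf hi hip]

end Equiv.Perm

/-! ### Reduction to a `p`-cycle and the conclusion for symmetric groups. -/

-- The cycles of `u` commute, have order `p`, and are permuted by `C(u)`, so
-- `exists_commute_coeff_ne_zero` applies to the set of all of them.
open Equiv.Perm in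
theorem exists_cycle_commute_coeff_ne_zero {α : Type*} [Fintype α] [DecidableEq α] {k : Type*}
    [Field k] (p : ℕ) [Fact p.Prime] [CharP k p] {b : MonoidAlgebra k (Equiv.Perm α)}
    (hb : b ∈ Subring.center (MonoidAlgebra k (Equiv.Perm α))) (hbi : b * b = b)
    {u : Equiv.Perm α} (hu : orderOf u = p) (hbu : ∃ g, Commute u g ∧ b.coeff g ≠ 0) :
    ∃ c : Equiv.Perm α, c.IsCycle ∧ orderOf c = p ∧ ∃ g, Commute c g ∧ b.coeff g ≠ 0 := by
  have hp : p.Prime := Fact.out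
  have hord : ∀ s ∈ u.cycleFactorsFinset, orderOf s = p := fun s hs => by
    have hcyc := (mem_cycleFactorsFinset_iff.mp hs).1
    obtain ⟨x, hx⟩ := hcyc.nonempty_support
    have h1 : orderOf s ∣ p := by
      rw [cycle_is_cycleOf hx hs, ← hu]
      exact orderOf_cycleOf_dvd_orderOf u x
    refine (hp.eq_one_or_self_of_dvd _ h1).resolve_left fun h2 => hcyc.ne_one ?_
    exact orderOf_eq_one_iff.mp h2
  have hu1 : u ≠ 1 := fun h => hp.ne_one (by rw [← hu, h, orderOf_one])
  obtain ⟨c, hc⟩ : u.cycleFactorsFinset.Nonempty := by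
    rw [Finset.nonempty_iff_ne_empty]
    exact mt cycleFactorsFinset_eq_empty_iff.mp hu1
  obtain ⟨g, hg, hbg⟩ := exists_commute_coeff_ne_zero p hb hbi
    (by rw [← hu, pow_orderOf_eq_one]) u.cycleFactorsFinset
    (fun s hs => by rw [← hord s hs, pow_orderOf_eq_one])
    (fun s hs t ht => cycleFactorsFinset_mem_commute' u hs ht)
    (fun s hs => (self_mem_cycle_factors_commute hs).symm)
    (fun x hx s hs => by
      have h1 := (mem_cycleFactorsFinset_conj u x s).mpr hs
      rwa [← hx.eq, mul_inv_cancel_right] at h1) hbu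
  exact ⟨c, (mem_cycleFactorsFinset_iff.mp hc).1, hord c hc, g, hg c hc, hbg⟩

theorem mainTheorem6 (p : ℕ) [Fact p.Prime] (k : Type u) [Field k] [CharP k p] (n : ℕ)
    (b : MonoidAlgebra k (Equiv.Perm (Fin n))) (hb : IsBlockIdempotent b)
    (P : Subgroup (Equiv.Perm (Fin n))) (hP : IsDefectGroup b P) (hne : P ≠ ⊥) :
    Nontrivial (HochschildCohomology k hb.Block 1) := by
  obtain ⟨g, hbg, hpg⟩ : ∃ g, b.coeff g ≠ 0 ∧ p ∣ Nat.card (Subgroup.centralizer {g}) := by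
    -- Otherwise `b` is a trace from the trivial subgroup, and minimality forces `P = ⊥`.
    by_contra! hcon
    exact hne (le_bot_iff.mp (hP.2 (exists_relTrace_bot_eq p hb.central hcon) bot_le))
  obtain ⟨⟨u, hug⟩, hu⟩ := exists_prime_orderOf_dvd_card' p hpg
  rw [Subgroup.orderOf_mk] at hu
  obtain ⟨c, hc, hcp, hcg⟩ := exists_cycle_commute_coeff_ne_zero p hb.central hb.idem hu
    ⟨g, Subgroup.mem_centralizer_singleton_iff.mp hug, hbg⟩
  obtain ⟨a, ha⟩ := hc.nonempty_support
  rw [Equiv.Perm.mem_support] at ha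
  exact nontrivial_hochschildCohomology_corner_of_centralizer_hom p hcp
    (f := Equiv.Perm.cycleExponent k c a) (hc.cycleExponent_mul hcp ha)
    (by rw [hc.cycleExponent_eq (i := 1) hcp ha (by rw [pow_one]), Nat.cast_one])
    (fun d hcd hd => hc.mem_zpowers_of_cycleExponent_ne_zero hcp ha hcd hd)
    (fun i hi hip => hc.isConj_pow (by rw [hcp]; exact Fact.out) hi (by rwa [hcp]))
    hb.idem hb.central hcg
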